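/- Let $F$ be a field, $n\ge 0$ an integer, $0\ne\lambda\in F$, and let $A\in F^{n\times n}$ be nilpotent with nullity $k_0=\dim\{v\in F^n\mid vA=0\}$ (row vectors). Put $C_F(A,\lambda)=\{B\in F^{n\times n}\mid AB-\lambda BA=0\}$, and let $J_m$ denote the $m\times m$ matrix with entry $1$ in the positions $(i,i+1)$, $1\le i<m$, and $0$ elsewhere. Then $A$ has a Jordan form, that is, $A$ is conjugate in $\mathrm{GL}(n,F)$ to $\bigoplus_{i=1}^{k}J_{\mu_i}$ for some partition $\mu=(\mu_1\ge\cdots\ge\mu_k\ge1)$ of $n$; and for every such $\mu$ we have $k=k_0$ and $$\dim_F C_F(A,\lambda)=\sum_{i=1}^{\mu_1}(\mu'_i)^2\ \ge\ k_0^2,$$ where $\mu'_i=|\{j\mid\mu_j\ge i\}|$ are the parts of the conjugate partition. (For $n=0$ the partition is empty and both sides are $0$.) -/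

import Mathlib

/-- The twisted centralizer code `C_F(A, c) = {B | A B - c B A = 0}`, as an `F`-subspace of the
space of `n × n` matrices over `F`. -/
def twistedCentralizer {F : Type*} [Field F] {n : ℕ} (A : Matrix (Fin n) (Fin n) F) (c : F) :
    Submodule F (Matrix (Fin n) (Fin n) F) where
  carrier := {B | A * B - c • (B * A) = 0}
  zero_mem' := by simp
  add_mem' := by
    intro B C hB hC
    simp only [Set.mem_ofPred_eq, sub_eq_zero] at hB hC ⊢
    rw [mul_add, add_mul, smul_add, hB, hC]
  smul_mem' := by
    intro a B hB
    simp only [Set.mem_ofPred_eq, sub_eq_zero] at hB ⊢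
    rw [Matrix.mul_smul, Matrix.smul_mul, hB, smul_comm]

/-- The nullity of `A`: the dimension of its row null space `{v | v A = 0}`. -/
noncomputable def rowNullity {F : Type*} [Field F] {n : ℕ} (A : Matrix (Fin n) (Fin n) F) : ℕ :=
  Module.finrank F (LinearMap.ker A.vecMulLinear)

/-- The `m × m` nilpotent Jordan block: `1` in the positions `(i, i + 1)` and `0` elsewhere. -/
def nilJordanBlock (F : Type*) [Field F] (m : ℕ) : Matrix (Fin m) (Fin m) F :=
  Matrix.of fun i j => if (i : ℕ) + 1 = (j : ℕ) then 1 else 0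

/-- `⊕ᵢ J_{μᵢ}`, with rows and columns indexed by the pairs (block, position in the block). -/
def nilJordanMatrix (F : Type*) [Field F] {k : ℕ} (μ : Fin k → ℕ) :
    Matrix ((i : Fin k) × Fin (μ i)) ((i : Fin k) × Fin (μ i)) F :=
  Matrix.blockDiagonal' fun i => nilJordanBlock F (μ i)

/-- `μ = (μ₁ ≥ ⋯ ≥ μ_k ≥ 1)` is a partition of `n`. -/
def IsPartitionOf {k : ℕ} (μ : Fin k → ℕ) (n : ℕ) : Prop :=
  Antitone μ ∧ (∀ i, 1 ≤ μ i) ∧ ∑ i, μ i = n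

/-- `μ` is a partition of `n` and `A` is conjugate in `GL(n, F)` to `⊕ᵢ J_{μᵢ}`. The bijection `e`
numbers the pairs (block, position); a different numbering conjugates by a permutation matrix. -/
def HasJordanType {F : Type*} [Field F] {n k : ℕ} (A : Matrix (Fin n) (Fin n) F)
    (μ : Fin k → ℕ) : Prop :=
  IsPartitionOf μ n ∧
    ∃ (e : ((i : Fin k) × Fin (μ i)) ≃ Fin n) (P : Matrix.GeneralLinearGroup (Fin n) F),
      A = (P : Matrix (Fin n) (Fin n) F) * Matrix.reindex e e (nilJordanMatrix F μ) *
        ((P⁻¹ : Matrix.GeneralLinearGroup (Fin n) F) : Matrix (Fin n) (Fin n) F)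

/-- The part `μ'ᵢ = |{j | μⱼ ≥ i}|` of the conjugate partition (for `i ≥ 1`). -/
def conjPart {k : ℕ} (μ : Fin k → ℕ) (i : ℕ) : ℕ :=
  (Finset.univ.filter fun j => i ≤ μ j).card

/-- The largest part `μ₁` of a partition (`0` for the empty partition). -/
def largestPart {k : ℕ} (μ : Fin k → ℕ) : ℕ :=
  Finset.univ.sup μ

/-! Through `v ↦ vA`, `F^n` is an `X`-power torsion `F[X]`-module, hence a sum of modules
`F[X]/(X^m)`; their monomial bases give the Jordan form. The dimension is invariant under algebra
isomorphism, so take `A = ⊕ J_{μ i}`. On the `(i, j)` block of `B` the equation says that a step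
down a diagonal multiplies the entry by `c`. Diagonals that meet the left edge below the corner or,
as `c ≠ 0`, the bottom edge before the last column must vanish. The remaining `min (μ i) (μ j)`
diagonals are free (`twistedCommutantFirstRows`), and `∑ min (μ i) (μ j) = ∑ (μ'_t)²` by double
counting. The term `t = 1` is `k²`, with `k` the nullity because each block has a one-dimensional
kernel. -/

open Polynomial in
theorem exists_basis_quotient_span_X_pow (F : Type*) [Field F] (k : ℕ) :
    ∃ b : Module.Basis (Fin k) F (F[X] ⧸ Submodule.span F[X] {(X : F[X]) ^ k}),
      ∀ a, b a = Submodule.Quotient.mk (X ^ (a : ℕ)) := by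
  have hm : (X ^ k : F[X]).Monic := monic_X_pow k
  have hd : (AdjoinRoot.powerBasis' hm).dim = k := natDegree_X_pow k
  obtain ⟨b, hb⟩ : ∃ b : Module.Basis (Fin k) F (AdjoinRoot (X ^ k : F[X])),
      ∀ a, b a = AdjoinRoot.mk (X ^ k) (X ^ (a : ℕ)) :=
    ⟨(AdjoinRoot.powerBasis' hm).basis.reindex (finCongr hd), fun a => by
      rw [Module.Basis.reindex_apply, PowerBasis.basis_eq_pow]
      simp⟩
  -- `AdjoinRoot (X ^ k)` unfolds to this quotient.
  exact ⟨b, hb⟩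

theorem dfinsupp_basis_apply {R ι : Type*} {M η : ι → Type*} [DecidableEq ι] [Semiring R]
    [∀ i, AddCommMonoid (M i)] [∀ i, Module R (M i)] (b : ∀ i, Module.Basis (η i) R (M i))
    (i : ι) (a : η i) : DFinsupp.basis b ⟨i, a⟩ = DFinsupp.single i (b i a) := by
  classical
  rw [Module.Basis.apply_eq_iff]
  ext ⟨j, c⟩
  change (b j).repr (DFinsupp.single i (b i a) j) c = _
  by_cases h : i = j
  · subst h
    simp [Finsupp.single_apply]
  · simp [DFinsupp.single_eq_of_ne (Ne.symm h), h]

/-- A nilpotent endomorphism of a finite-dimensional space has a Jordan basis. -/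
theorem exists_jordan_basis {F V : Type*} [Field F] [AddCommGroup V] [Module F V]
    [FiniteDimensional F V] (f : Module.End F V) (hf : IsNilpotent f) :
    ∃ (d : ℕ) (k : Fin d → ℕ) (b : Module.Basis ((i : Fin d) × Fin (k i)) F V), ∀ i a,
      f (b ⟨i, a⟩) = if h : (a : ℕ) + 1 < k i then b ⟨i, ⟨a + 1, h⟩⟩ else 0 := by
  classical
  open Polynomial in
  obtain ⟨N, hN⟩ := hf
  have ht : Module.IsTorsion' (Module.AEval' f) (Submonoid.powers (X : F[X])) := by
    intro x
    refine ⟨⟨X ^ N, N, rfl⟩, ?_⟩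
    obtain ⟨v, rfl⟩ := (Module.AEval'.of f).surjective x
    change (X ^ N : F[X]) • Module.AEval'.of f v = 0
    rw [Module.AEval'.X_pow_smul_of, hN]
    simp
  obtain ⟨d, k, ⟨e⟩⟩ := Module.torsion_by_prime_power_decomposition
    (irreducible_X : Irreducible (X : F[X])) ht
  choose b hb using fun i => exists_basis_quotient_span_X_pow F (k i)
  let B : Module.Basis ((i : Fin d) × Fin (k i)) F
    (DirectSum (Fin d) fun i => F[X] ⧸ Submodule.span F[X] {(X : F[X]) ^ k i}) :=
    DFinsupp.basis b
  have hB : ∀ i a, B ⟨i, a⟩ = DirectSum.lof F[X] _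
      (fun i => F[X] ⧸ Submodule.span F[X] {(X : F[X]) ^ k i}) i (b i a) := by
    intro i a
    exact dfinsupp_basis_apply b i a
  let E := (Module.AEval'.of f).trans (e.restrictScalars F)
  refine ⟨d, k, B.map E.symm, fun i a => E.injective ?_⟩
  have hE : ∀ v, E (f v) = (X : F[X]) • E v := fun v => by
    change e (Module.AEval'.of f (f v)) = (X : F[X]) • e (Module.AEval'.of f v)
    rw [← map_smul, Module.AEval'.X_smul_of]
  have hX : (X : F[X]) • b i a = Submodule.Quotient.mk (X ^ ((a : ℕ) + 1)) := by
    rw [hb, ← Submodule.Quotient.mk_smul, smul_eq_mul, pow_succ']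
  rw [hE, Module.Basis.map_apply, LinearEquiv.apply_symm_apply, hB, ← map_smul, hX]
  split_ifs with h
  · rw [Module.Basis.map_apply, LinearEquiv.apply_symm_apply, hB, hb]
  -- The top monomial of a block is sent to `X ^ k i`, which is zero in the quotient.
  · have : (a : ℕ) + 1 = k i := by omega
    rw [map_zero, this, (Submodule.Quotient.mk_eq_zero _).2 (Submodule.mem_span_singleton_self _),
      map_zero]

theorem exists_equiv_antitone_comp {ι : Type*} [Fintype ι] (f : ι → ℕ) :
    ∃ σ : Fin (Fintype.card ι) ≃ ι, Antitone (f ∘ σ) := by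
  let g : Fin (Fintype.card ι) → ℕᵒᵈ := fun i => OrderDual.toDual (f ((Fintype.equivFin ι).symm i))
  exact ⟨(Tuple.sort g).trans (Fintype.equivFin ι).symm, fun i j h => Tuple.monotone_sort g h⟩

/-- The module decomposition may give unsorted or zero exponents. A zero block contains no
positions, so discarding it keeps the set of pairs. -/
theorem exists_antitone_pos_sigma_equiv {d : ℕ} (k : Fin d → ℕ) :
    ∃ (m : ℕ) (μ : Fin m → ℕ) (σ : Fin m → Fin d) (hσ : ∀ i, μ i = k (σ i)), Antitone μ ∧
      (∀ i, 1 ≤ μ i) ∧ ∃ s : ((i : Fin m) × Fin (μ i)) ≃ ((i : Fin d) × Fin (k i)),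
        ∀ i a, s ⟨i, a⟩ = ⟨σ i, Fin.cast (hσ i) a⟩ := by
  obtain ⟨σ, hσ⟩ := exists_equiv_antitone_comp fun i : {i // 1 ≤ k i} => k i
  refine ⟨_, fun i => k (σ i), fun i => σ i, fun _ => rfl, hσ, fun i => (σ i).2,
    Equiv.ofBijective (fun x => ⟨σ x.1, x.2⟩) ⟨?_, ?_⟩, fun _ _ => rfl⟩
  · rintro ⟨i, a⟩ ⟨j, b⟩ h
    simp only [Sigma.mk.injEq, Subtype.val_inj, σ.injective.eq_iff] at h
    obtain ⟨rfl, h⟩ := h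
    simpa using h
  · rintro ⟨i, a⟩
    obtain ⟨j, hj⟩ := σ.surjective ⟨i, by have := a.2; omega⟩
    obtain rfl : ((σ j : {i // 1 ≤ k i}) : Fin d) = i := by rw [hj]
    exact ⟨⟨j, a⟩, rfl⟩

theorem nilJordanMatrix_apply {F : Type*} [Field F] {k : ℕ} (μ : Fin k → ℕ) (i j : Fin k)
    (a : Fin (μ i)) (b : Fin (μ j)) :
    nilJordanMatrix F μ ⟨i, a⟩ ⟨j, b⟩ = if i = j ∧ (a : ℕ) + 1 = b then 1 else 0 := by
  by_cases h : i = j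
  · subst h
    simp [nilJordanMatrix, nilJordanBlock]
  · simp [nilJordanMatrix, Matrix.blockDiagonal'_apply_ne, h]

theorem sum_nilJordanMatrix_smul {F V : Type*} [Field F] [AddCommGroup V] [Module F V] {k : ℕ}
    (μ : Fin k → ℕ) (i : Fin k) (a : Fin (μ i)) (v : ((i : Fin k) × Fin (μ i)) → V) :
    ∑ y, nilJordanMatrix F μ ⟨i, a⟩ y • v y =
      if h : (a : ℕ) + 1 < μ i then v ⟨i, ⟨a + 1, h⟩⟩ else 0 := by
  split_ifs with h
  · rw [Finset.sum_eq_single ⟨i, ⟨a + 1, h⟩⟩]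
    · simp [nilJordanMatrix_apply]
    · rintro ⟨j, b⟩ - hne
      rw [nilJordanMatrix_apply, if_neg, zero_smul]
      rintro ⟨rfl, hb⟩
      exact hne (by simp [hb])
    · simp
  · refine Finset.sum_eq_zero ?_
    rintro ⟨j, b⟩ -
    rw [nilJordanMatrix_apply, if_neg, zero_smul]
    rintro ⟨rfl, hb⟩
    omega

theorem sum_smul_nilJordanMatrix {F V : Type*} [Field F] [AddCommGroup V] [Module F V] {k : ℕ}
    (μ : Fin k → ℕ) (i : Fin k) (a : Fin (μ i)) (v : ((i : Fin k) × Fin (μ i)) → V) :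
    ∑ y, nilJordanMatrix F μ y ⟨i, a⟩ • v y =
      if (a : ℕ) = 0 then 0 else v ⟨i, ⟨a - 1, by omega⟩⟩ := by
  split_ifs with h
  · refine Finset.sum_eq_zero ?_
    rintro ⟨j, b⟩ -
    rw [nilJordanMatrix_apply, if_neg, zero_smul]
    rintro ⟨rfl, hb⟩
    omega
  · rw [Finset.sum_eq_single ⟨i, ⟨a - 1, by omega⟩⟩]
    · rw [nilJordanMatrix_apply, if_pos ⟨rfl, by simp; omega⟩, one_smul]
    · rintro ⟨j, b⟩ - hne
      rw [nilJordanMatrix_apply, if_neg, zero_smul]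
      rintro ⟨rfl, hb⟩
      exact hne (by simp [← hb])
    · simp

/-- A nilpotent matrix has a Jordan form. -/
theorem exists_hasJordanType {F : Type*} [Field F] {n : ℕ} (A : Matrix (Fin n) (Fin n) F)
    (hA : IsNilpotent A) : ∃ (k : ℕ) (μ : Fin k → ℕ), HasJordanType A μ := by
  have hf : IsNilpotent (A.vecMulLinear : Module.End F (Fin n → F)) := by
    obtain ⟨N, hN⟩ := hA
    refine ⟨N, LinearMap.ext fun v => ?_⟩
    have : ∀ m : ℕ, ((A.vecMulLinear : Module.End F (Fin n → F)) ^ m) v = Matrix.vecMul v (A ^ m) := by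
      intro m
      induction m with
      | zero => simp
      | succ m ih => rw [pow_succ', Module.End.mul_apply, ih, pow_succ]; simp [Matrix.vecMul_vecMul]
    rw [this, hN]
    simp
  obtain ⟨d, k, b, hb⟩ := exists_jordan_basis _ hf
  obtain ⟨m, μ, σ, hσ, hanti, hpos, s, hs⟩ := exists_antitone_pos_sigma_equiv k
  let b' := b.reindex s.symm
  have hb' : ∀ i a, Matrix.vecMul (b' ⟨i, a⟩) A =
      if h : (a : ℕ) + 1 < μ i then b' ⟨i, ⟨a + 1, h⟩⟩ else 0 := by
    intro i a
    have := hb (σ i) (Fin.cast (hσ i) a)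
    simpa [b', hs, hσ] using this
  have hcard : Fintype.card ((i : Fin m) × Fin (μ i)) = n := by
    rw [← Module.finrank_eq_card_basis b', Module.finrank_fin_fun]
  let e : ((i : Fin m) × Fin (μ i)) ≃ Fin n := Fintype.equivFinOfCardEq hcard
  let Q : Matrix (Fin n) (Fin n) F := Matrix.of fun r => b' (e.symm r)
  have hQ : IsUnit Q := by
    rw [← Matrix.linearIndependent_rows_iff_isUnit]
    exact b'.linearIndependent.comp _ e.symm.injective
  have hQA : Q * A = Matrix.reindex e e (nilJordanMatrix F μ) * Q := by
    ext r c
    obtain ⟨⟨i, a⟩, rfl⟩ := e.surjective r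
    have h1 : (Q * A) (e ⟨i, a⟩) c = Matrix.vecMul (b' ⟨i, a⟩) A c := by
      simp [Q, Matrix.mul_apply, Matrix.vecMul, dotProduct]
    rw [h1, hb', Matrix.mul_apply, ← e.sum_comp]
    simp only [Matrix.reindex_apply, Matrix.submatrix_apply, Equiv.symm_apply_apply, Q,
      Matrix.of_apply]
    have := sum_nilJordanMatrix_smul (F := F) μ i a b'
    rw [← this]
    simp
  -- The rows of `Q` are the Jordan basis, so `Q A = J Q` and the conjugator is `Q⁻¹`.
  refine ⟨m, μ, ⟨hanti, hpos, ?_⟩, e, hQ.unit⁻¹, ?_⟩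
  · simpa using hcard
  · rw [inv_inv, mul_assoc, hQ.unit_spec, ← hQA, ← mul_assoc]
    have : ((hQ.unit⁻¹ : Matrix.GeneralLinearGroup (Fin n) F) : Matrix (Fin n) (Fin n) F) * Q = 1 :=
      hQ.unit.inv_mul
    rw [this, one_mul]


/-! ### Dimension of the twisted centralizer -/

/-- The solutions `b` of `a * b = c • (b * a)` in an algebra. -/
def twistedCommutant {F R : Type*} [Field F] [Ring R] [Algebra F R] (a : R) (c : F) :
    Submodule F R :=
  LinearMap.ker (LinearMap.mulLeft F a - c • LinearMap.mulRight F a)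

theorem mem_twistedCommutant {F R : Type*} [Field F] [Ring R] [Algebra F R] {a b : R} {c : F} :
    b ∈ twistedCommutant a c ↔ a * b = c • (b * a) := by
  simp [twistedCommutant, sub_eq_zero]

theorem twistedCentralizer_eq_twistedCommutant {F : Type*} [Field F] {n : ℕ}
    (A : Matrix (Fin n) (Fin n) F) (c : F) : twistedCentralizer A c = twistedCommutant A c := by
  ext B
  rw [mem_twistedCommutant, ← sub_eq_zero]
  rfl

theorem finrank_twistedCommutant_map {F R S : Type*} [Field F] [Ring R] [Algebra F R] [Ring S]
    [Algebra F S] (φ : R ≃ₐ[F] S) (a : R) (c : F) :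
    Module.finrank F (twistedCommutant (φ a) c) = Module.finrank F (twistedCommutant a c) := by
  have h : twistedCommutant a c = (twistedCommutant (φ a) c).comap (φ.toLinearEquiv : R →ₗ[F] S) := by
    ext b
    simp only [Submodule.mem_comap, mem_twistedCommutant, LinearEquiv.coe_coe,
      AlgEquiv.toLinearEquiv_apply, ← map_mul, ← map_smul, φ.injective.eq_iff]
  rw [h]
  exact (φ.toLinearEquiv.ofSubmodule' (twistedCommutant (φ a) c)).finrank_eq.symm

theorem HasJordanType.exists_algEquiv {F : Type*} [Field F] {n k : ℕ}
    {A : Matrix (Fin n) (Fin n) F} {μ : Fin k → ℕ} (h : HasJordanType A μ) :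
    ∃ φ : Matrix ((i : Fin k) × Fin (μ i)) ((i : Fin k) × Fin (μ i)) F ≃ₐ[F]
      Matrix (Fin n) (Fin n) F, φ (nilJordanMatrix F μ) = A := by
  obtain ⟨-, e, P, rfl⟩ := h
  exact ⟨(Matrix.reindexAlgEquiv F F e).trans
    (MulSemiringAction.toAlgEquiv F (Matrix (Fin n) (Fin n) F) (ConjAct.toConjAct P)), rfl⟩

theorem mem_twistedCommutant_nilJordanMatrix {F : Type*} [Field F] {k : ℕ} {μ : Fin k → ℕ} {c : F}
    {B : Matrix ((i : Fin k) × Fin (μ i)) ((i : Fin k) × Fin (μ i)) F} :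
    B ∈ twistedCommutant (nilJordanMatrix F μ) c ↔
      ∀ (i : Fin k) (a : Fin (μ i)) (j : Fin k) (b : Fin (μ j)),
        (if h : (a : ℕ) + 1 < μ i then B ⟨i, ⟨a + 1, h⟩⟩ ⟨j, b⟩ else 0) =
          c * if (b : ℕ) = 0 then 0 else B ⟨i, a⟩ ⟨j, ⟨b - 1, by omega⟩⟩ := by
  have hL : ∀ (i : Fin k) (a : Fin (μ i)) y, (nilJordanMatrix F μ * B) ⟨i, a⟩ y =
      if h : (a : ℕ) + 1 < μ i then B ⟨i, ⟨a + 1, h⟩⟩ y else 0 := fun i a y =>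
    (Matrix.mul_apply ..).trans (sum_nilJordanMatrix_smul (F := F) μ i a fun x => B x y)
  have hR : ∀ x (j : Fin k) (b : Fin (μ j)), (B * nilJordanMatrix F μ) x ⟨j, b⟩ =
      if (b : ℕ) = 0 then 0 else B x ⟨j, ⟨b - 1, by omega⟩⟩ := fun x j b => by
    refine Eq.trans ?_ (sum_smul_nilJordanMatrix (F := F) μ j b fun y => B x y)
    simp only [Matrix.mul_apply, smul_eq_mul, mul_comm]
  rw [mem_twistedCommutant]
  constructor
  · intro h i a j b
    rw [← hL, ← hR, h, Matrix.smul_apply, smul_eq_mul]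
  · intro h
    ext ⟨i, a⟩ ⟨j, b⟩
    rw [Matrix.smul_apply, smul_eq_mul, hL, hR, h]

/-- In a member of the twisted centralizer of a Jordan matrix, the block in position `(i, j)` is
determined by the last `min (μ i) (μ j)` entries of its first row. -/
def twistedCommutantFirstRows {F : Type*} [Field F] {k : ℕ} (μ : Fin k → ℕ) (c : F) :
    twistedCommutant (nilJordanMatrix F μ) c →ₗ[F]
      ((p : Fin k × Fin k) × Fin (min (μ p.1) (μ p.2)) → F) where
  toFun B x := B.1 ⟨x.1.1, ⟨0, by have := x.2.2; omega⟩⟩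
    ⟨x.1.2, ⟨μ x.1.2 - 1 - x.2, by have := x.2.2; omega⟩⟩
  map_add' _ _ := rfl
  map_smul' _ _ := rfl

theorem twistedCommutantFirstRows_apply {F : Type*} [Field F] {k : ℕ} (μ : Fin k → ℕ) (c : F)
    (B : twistedCommutant (nilJordanMatrix F μ) c) (i j : Fin k) (t : Fin (min (μ i) (μ j))) :
    twistedCommutantFirstRows μ c B ⟨(i, j), t⟩ =
      B.1 ⟨i, ⟨0, by have := t.2; omega⟩⟩ ⟨j, ⟨μ j - 1 - t, by have := t.2; omega⟩⟩ :=
  rfl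

theorem twistedCommutant_diagonal_eq {F : Type*} [Field F] {k : ℕ} {μ : Fin k → ℕ} {c : F}
    {B : Matrix ((i : Fin k) × Fin (μ i)) ((i : Fin k) × Fin (μ i)) F}
    (hB : B ∈ twistedCommutant (nilJordanMatrix F μ) c) (i j : Fin k) (b s : ℕ) (hs : s < μ i)
    (hb : b + s < μ j) :
    B ⟨i, ⟨s, hs⟩⟩ ⟨j, ⟨b + s, hb⟩⟩ =
      c ^ s * B ⟨i, ⟨0, by omega⟩⟩ ⟨j, ⟨b, by omega⟩⟩ := by
  induction s with
  | zero => simp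
  | succ s ih =>
    have h := mem_twistedCommutant_nilJordanMatrix.1 hB i ⟨s, by omega⟩ j ⟨b + (s + 1), hb⟩
    rw [dif_pos hs, if_neg (by simp)] at h
    rw [h, pow_succ', mul_assoc, ← ih (by omega) (by omega)]
    rfl

theorem twistedCommutantFirstRows_injective {F : Type*} [Field F] {k : ℕ} (μ : Fin k → ℕ) {c : F}
    (hc : c ≠ 0) : Function.Injective (twistedCommutantFirstRows μ c) := by
  rw [injective_iff_map_eq_zero]
  rintro ⟨B, hB⟩ h0
  have hrow : ∀ (i j : Fin k) (hi : 0 < μ i) (b : Fin (μ j)), B ⟨i, ⟨0, hi⟩⟩ ⟨j, b⟩ = 0 := by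
    intro i j hi b
    by_cases hb : (b : ℕ) + μ i < μ j
    · have h1 := twistedCommutant_diagonal_eq hB i j b (μ i - 1) (by omega) (by omega)
      have h2 := mem_twistedCommutant_nilJordanMatrix.1 hB i ⟨μ i - 1, by omega⟩ j ⟨b + μ i, hb⟩
      have h3 : (b : ℕ) + μ i - 1 = b + (μ i - 1) := by omega
      rw [dif_neg (by simp; omega), if_neg (by simp; omega)] at h2
      simp only [h3, h1] at h2
      simpa [hc] using h2.symm
    · have hb2 := b.2
      have h1 := congrFun h0 ⟨(i, j), ⟨μ j - 1 - b, by simp only [lt_min_iff]; omega⟩⟩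
      have h2 : μ j - 1 - (μ j - 1 - (b : ℕ)) = b := by omega
      rw [twistedCommutantFirstRows_apply] at h1
      simpa only [h2, Pi.zero_apply] using h1
  have hall : ∀ (a : ℕ) (i j : Fin k) (ha : a < μ i) (b : Fin (μ j)), B ⟨i, ⟨a, ha⟩⟩ ⟨j, b⟩ = 0 := by
    intro a
    induction a with
    | zero => exact hrow
    | succ a ih =>
      intro i j ha b
      have h := mem_twistedCommutant_nilJordanMatrix.1 hB i ⟨a, by omega⟩ j b
      rw [dif_pos ha, ih, ite_self, mul_zero] at h
      exact h
  refine Subtype.ext ?_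
  ext ⟨i, a⟩ ⟨j, b⟩
  exact hall a i j a.2 b

theorem twistedCommutantFirstRows_surjective {F : Type*} [Field F] {k : ℕ} (μ : Fin k → ℕ) (c : F) :
    Function.Surjective (twistedCommutantFirstRows μ c) := by
  intro v
  -- `t` counts diagonals from the top right corner; those with `t ≥ min (μ i) (μ j)` get the forced
  -- value `0`.
  let w : Fin k → Fin k → ℕ → F := fun i j t =>
    if h : t < min (μ i) (μ j) then v ⟨(i, j), ⟨t, h⟩⟩ else 0
  let B : Matrix ((i : Fin k) × Fin (μ i)) ((i : Fin k) × Fin (μ i)) F := fun x y =>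
    if (x.2 : ℕ) ≤ y.2 then c ^ (x.2 : ℕ) * w x.1 y.1 (μ y.1 - 1 - (y.2 - x.2)) else 0
  refine ⟨⟨B, mem_twistedCommutant_nilJordanMatrix.2 ?_⟩, ?_⟩
  · rintro i ⟨a, ha⟩ j ⟨b, hb⟩
    rcases Nat.eq_zero_or_pos b with rfl | hb0
    · simp [B]
    · simp only [B, if_neg hb0.ne']
      by_cases hab : a + 1 ≤ b
      · rw [if_pos hab, if_pos (by omega)]
        have h1 : b - 1 - a = b - (a + 1) := by omega
        rw [h1]
        split_ifs with h
        · ring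
        -- Here `a + 1 = μ i` and `b < μ j`, so the diagonal index is at least `μ i`.
        · have : w i j (μ j - 1 - (b - (a + 1))) = 0 := dif_neg (by rw [lt_min_iff]; omega)
          rw [this, mul_zero, mul_zero]
      · rw [if_neg hab, if_neg (by omega), dite_eq_ite, ite_self, mul_zero]
  · ext ⟨⟨i, j⟩, t, ht⟩
    have ht' := lt_min_iff.1 ht
    have h1 : μ j - 1 - (μ j - 1 - t) = t := by simp only at ht'; omega
    rw [twistedCommutantFirstRows_apply]
    simp only [B, w, Nat.zero_le, if_true, pow_zero, one_mul, Nat.sub_zero, h1]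
    exact dif_pos ht

theorem finrank_twistedCommutant_nilJordanMatrix {F : Type*} [Field F] {k : ℕ} (μ : Fin k → ℕ)
    {c : F} (hc : c ≠ 0) :
    Module.finrank F (twistedCommutant (nilJordanMatrix F μ) c) =
      ∑ i, ∑ j, min (μ i) (μ j) := by
  rw [(LinearEquiv.ofBijective (twistedCommutantFirstRows μ c)
    ⟨twistedCommutantFirstRows_injective μ hc, twistedCommutantFirstRows_surjective μ c⟩).finrank_eq,
    Module.finrank_fintype_fun_eq_card, Fintype.card_sigma, Fintype.sum_prod_type]
  simp

/-- Both sides count the triples `(t, i, j)` with `1 ≤ t ≤ min (μ i) (μ j)`. -/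
theorem sum_conjPart_sq {k : ℕ} (μ : Fin k → ℕ) :
    ∑ t ∈ Finset.Icc 1 (largestPart μ), conjPart μ t ^ 2 = ∑ i, ∑ j, min (μ i) (μ j) := by
  have h : ∀ t, conjPart μ t ^ 2 = ∑ i, ∑ j, if t ≤ min (μ i) (μ j) then 1 else 0 := by
    intro t
    rw [conjPart, Finset.card_filter, sq, Finset.sum_mul_sum]
    simp only [le_min_iff, ite_and, mul_ite, mul_one, mul_zero]
    refine Finset.sum_congr rfl fun i _ => Finset.sum_congr rfl fun j _ => ?_
    split_ifs <;> rfl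
  simp only [h]
  rw [Finset.sum_comm]
  refine Finset.sum_congr rfl fun i _ => ?_
  rw [Finset.sum_comm]
  refine Finset.sum_congr rfl fun j _ => ?_
  rw [← Finset.card_filter]
  have hi : μ i ≤ largestPart μ := Finset.le_sup (f := μ) (Finset.mem_univ i)
  have : (Finset.Icc 1 (largestPart μ)).filter (fun t => t ≤ min (μ i) (μ j)) =
      Finset.Icc 1 (min (μ i) (μ j)) := by
    ext t
    simp only [Finset.mem_filter, Finset.mem_Icc, le_min_iff]
    omega
  rw [this, Nat.card_Icc, Nat.add_sub_cancel]

/-! ### Nullity and the lower bound -/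

theorem finrank_ker_vecMulLinear_add_rank {F σ : Type*} [Field F] [Fintype σ] [DecidableEq σ]
    (M : Matrix σ σ F) :
    Module.finrank F (LinearMap.ker M.vecMulLinear) + M.rank = Fintype.card σ := by
  rw [Matrix.rank_eq_finrank_span_row, ← _root_.range_vecMulLinear, add_comm,
    LinearMap.finrank_range_add_finrank_ker, Module.finrank_fintype_fun_eq_card]

theorem finrank_ker_vecMulLinear_nilJordanMatrix {F : Type*} [Field F] {k : ℕ} (μ : Fin k → ℕ)
    (hμ : ∀ i, 1 ≤ μ i) :
    Module.finrank F (LinearMap.ker (nilJordanMatrix F μ).vecMulLinear) = k := by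
  have hmem : ∀ v, v ∈ LinearMap.ker (nilJordanMatrix F μ).vecMulLinear ↔
      ∀ (i : Fin k) (a : Fin (μ i)), (a : ℕ) + 1 < μ i → v ⟨i, a⟩ = 0 := by
    intro v
    have h : ∀ (i : Fin k) (a : Fin (μ i)), Matrix.vecMul v (nilJordanMatrix F μ) ⟨i, a⟩ =
        if (a : ℕ) = 0 then 0 else v ⟨i, ⟨a - 1, by omega⟩⟩ := fun i a => by
      refine Eq.trans ?_ (sum_smul_nilJordanMatrix (F := F) μ i a v)
      simp only [smul_eq_mul, mul_comm, Matrix.vecMul, dotProduct]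
    rw [LinearMap.mem_ker, Matrix.vecMulLinear_apply]
    constructor
    · intro hv i a ha
      have := h i ⟨a + 1, ha⟩
      rw [hv, if_neg (by simp)] at this
      exact this.symm
    · intro hv
      ext ⟨i, a⟩
      rw [h]
      split_ifs with ha
      · rfl
      · exact hv _ _ (by simp only; omega)
  -- A kernel vector is supported on the last position of each block, where it is arbitrary.
  let χ : LinearMap.ker (nilJordanMatrix F μ).vecMulLinear →ₗ[F] (Fin k → F) :=
    { toFun := fun v i => v.1 ⟨i, ⟨μ i - 1, by have := hμ i; omega⟩⟩
      map_add' := fun _ _ => rfl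
      map_smul' := fun _ _ => rfl }
  have hχ : Function.Bijective χ := by
    constructor
    · rw [injective_iff_map_eq_zero]
      rintro ⟨v, hv⟩ h0
      refine Subtype.ext ?_
      ext ⟨i, a, ha⟩
      by_cases h : a + 1 < μ i
      · exact (hmem v).1 hv i ⟨a, ha⟩ h
      · obtain rfl : a = μ i - 1 := by omega
        exact congrFun h0 i
    · intro u
      refine ⟨⟨fun x => if (x.2 : ℕ) + 1 < μ x.1 then 0 else u x.1, (hmem _).2 ?_⟩, ?_⟩
      · intro i a ha
        exact if_pos ha
      · ext i
        exact if_neg (by simp only; omega)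
  rw [(LinearEquiv.ofBijective χ hχ).finrank_eq, Module.finrank_fin_fun]

theorem HasJordanType.rowNullity_eq {F : Type*} [Field F] {n k : ℕ}
    {A : Matrix (Fin n) (Fin n) F} {μ : Fin k → ℕ} (h : HasJordanType A μ) :
    rowNullity A = k := by
  obtain ⟨⟨-, hpos, -⟩, e, P, rfl⟩ := h
  have hP : IsUnit (P : Matrix (Fin n) (Fin n) F).det := (Matrix.isUnit_iff_isUnit_det _).1 P.isUnit
  have hP' : IsUnit ((P⁻¹ : Matrix.GeneralLinearGroup (Fin n) F) : Matrix (Fin n) (Fin n) F).det :=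
    (Matrix.isUnit_iff_isUnit_det _).1 (P⁻¹).isUnit
  have h1 := finrank_ker_vecMulLinear_add_rank
    ((P : Matrix (Fin n) (Fin n) F) * Matrix.reindex e e (nilJordanMatrix F μ) *
      ((P⁻¹ : Matrix.GeneralLinearGroup (Fin n) F) : Matrix (Fin n) (Fin n) F))
  rw [Matrix.rank_mul_eq_left_of_isUnit_det _ _ hP', Matrix.rank_mul_eq_right_of_isUnit_det _ _ hP,
    Matrix.rank_reindex, ← Fintype.card_congr e,
    ← finrank_ker_vecMulLinear_add_rank (nilJordanMatrix F μ),
    finrank_ker_vecMulLinear_nilJordanMatrix μ hpos] at h1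
  exact Nat.add_right_cancel h1

theorem sq_le_sum_conjPart_sq {k : ℕ} (μ : Fin k → ℕ) (hμ : ∀ i, 1 ≤ μ i) :
    k ^ 2 ≤ ∑ t ∈ Finset.Icc 1 (largestPart μ), conjPart μ t ^ 2 := by
  rcases Nat.eq_zero_or_pos k with rfl | hk
  · simp
  have h1 : conjPart μ 1 = k := by simp [conjPart, hμ]
  have h2 : 1 ≤ largestPart μ :=
    (hμ ⟨0, hk⟩).trans (Finset.le_sup (f := μ) (Finset.mem_univ _))
  calc k ^ 2 = conjPart μ 1 ^ 2 := by rw [h1]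
    _ ≤ _ := Finset.single_le_sum (f := fun t => conjPart μ t ^ 2) (fun _ _ => Nat.zero_le _)
      (Finset.mem_Icc.2 ⟨le_rfl, h2⟩)

theorem theorem2p5 {F : Type*} [Field F] {n : ℕ} (A : Matrix (Fin n) (Fin n) F)
    (hA : IsNilpotent A) (c : F) (hc : c ≠ 0) :
    (∃ (k : ℕ) (μ : Fin k → ℕ), HasJordanType A μ) ∧
    ∀ (k : ℕ) (μ : Fin k → ℕ), HasJordanType A μ →
      k = rowNullity A ∧
      Module.finrank F (twistedCentralizer A c) =
        ∑ i ∈ Finset.Icc 1 (largestPart μ), conjPart μ i ^ 2 ∧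
      ∑ i ∈ Finset.Icc 1 (largestPart μ), conjPart μ i ^ 2 ≥ rowNullity A ^ 2 := by
  refine ⟨exists_hasJordanType A hA, fun k μ h => ⟨h.rowNullity_eq.symm, ?_, ?_⟩⟩
  · obtain ⟨φ, hφ⟩ := h.exists_algEquiv
    rw [twistedCentralizer_eq_twistedCommutant, ← hφ, finrank_twistedCommutant_map,
      finrank_twistedCommutant_nilJordanMatrix μ hc, sum_conjPart_sq]
  · rw [h.rowNullity_eq]
    exact sq_le_sum_conjPart_sq μ h.1.2.1
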